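/- Let $\Sigma$ be a finite alphabet. A timed word over $\Sigma$ is a finite sequence $(t_1\cdot a_1)\cdots(t_n\cdot a_n)$ with delays $t_i\in\mathbb{R}_{\ge 0}$ and letters $a_i\in\Sigma$; a timed language is a set of timed words, and the residual of $L$ by $u$ is $u^{-1}L=\{w\mid uw\in L\}$. A one-clock timed automaton over $\Sigma$ has a finite set $Q$ of states, an initial state $q_I\in Q$, a set $F\subseteq Q$ of final states, and a finite set of transitions $(q,q',a,\phi,r)$ with $q,q'\in Q$, $a\in\Sigma$, $r\in\{0,1\}$ and a guard $\phi$ given by $\phi::= c<x\mid x=c\mid x<c\mid\phi\wedge\phi$ with $c\in\mathbb{N}$. A run starts in state $q_I$ with clock value $0$; reading $(t\cdot a)$ in state $q$ with clock value $\nu$, it takes a transition $(q,q',a,\phi,r)$ such that $\nu+t$ satisfies $\phi$, and moves to state $q'$ with clock value $(\nu+t)\cdot r$. A timed word is accepted if some run on it ends in a final state. The automaton is deterministic (a $1$-DTA) if any two distinct transitions with the same source and the same letter have guards that no clock value satisfies both. A timed language is $1$-DTA recognizable if it is the set of timed words accepted by some $1$-DTA. A timed word is half-integral if each of its delays is of the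 form $\frac m2$ with $m\in\mathbb{N}$; $\mathcal{HI}(L)$ denotes the set of half-integral words in $L$. The syntactic reset function $\mathbf{R}^L$ of a timed language $L$ maps timed words to non-negative reals and is defined inductively by $\mathbf{R}^L(\epsilon)=0$ and \[\mathbf{R}^L(u(t\cdot a))=\begin{cases}0&\text{if }(u(t\cdot a))^{-1}L\text{ is }1\text{-DTA recognizable},\\ \mathbf{R}^L(u)+t&\text{otherwise.}\end{cases}\] Theorem. If $L_1$ and $L_2$ are $1$-DTA recognizable timed languages over $\Sigma$, then $L_1=L_2$ if and only if $\mathcal{HI}(L_1)=\mathcal{HI}(L_2)$ and $\mathbf{R}^{L_1}=\mathbf{R}^{L_2}$. -/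

import Mathlib

open scoped NNReal

namespace OneClock

/-- A timed word `(t₁ · a₁) ⋯ (tₙ · aₙ)` over the alphabet `α`: a finite sequence of pairs of a delay
and a letter. -/
abbrev TimedWord (α : Type*) := List (ℝ≥0 × α)

/-- A timed language is a set of timed words. -/
abbrev TimedLanguage (α : Type*) := Set (TimedWord α)

/-- The residual language `u⁻¹L = {w | uw ∈ L}`. -/
def residual {α : Type*} (L : TimedLanguage α) (u : TimedWord α) : TimedLanguage α :=
  {w | u ++ w ∈ L}

/-- Clock constraints `φ ::= c < x | x = c | x < c | φ ∧ φ` with `c` a natural number. -/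
inductive ClockConstraint : Type
  | gt (c : ℕ) : ClockConstraint
  | eq (c : ℕ) : ClockConstraint
  | lt (c : ℕ) : ClockConstraint
  | and (φ ψ : ClockConstraint) : ClockConstraint

/-- The set of clock values that satisfy a clock constraint. -/
def ClockConstraint.sat : ClockConstraint → Set ℝ≥0
  | gt c => {x | (c : ℝ≥0) < x}
  | eq c => {x | x = (c : ℝ≥0)}
  | lt c => {x | x < (c : ℝ≥0)}
  | and φ ψ => φ.sat ∩ ψ.sat

/-- A transition with its source, target, letter, guard, and the information whether the clock is
reset (`reset = true`) or not (`reset = false`). -/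
structure Transition (Q α : Type*) where
  src : Q
  tgt : Q
  letter : α
  guard : ClockConstraint
  reset : Bool

/-- A one-clock timed automaton with state set `Q` over the alphabet `α`. The state set is required
to be finite where automata are used. -/
structure OneTA (Q α : Type*) where
  init : Q
  trans : Set (Transition Q α)
  finite_trans : trans.Finite
  final : Set Q

namespace OneTA

variable {Q α : Type*}

/-- Distinct transitions differ in their source or in their letter, or have disjoint guards. -/
def IsDeterministic (A : OneTA Q α) : Prop :=
  ∀ θ ∈ A.trans, ∀ θ' ∈ A.trans, θ ≠ θ' →
    θ.src ≠ θ'.src ∨ θ.letter ≠ θ'.letter ∨ θ.guard.sat ∩ θ'.guard.sat = ∅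

/-- `A.Reaches q ν w q' ν'`: there is a run of `A` on `w` from the configuration `(q, ν)` to the
configuration `(q', ν')`. -/
inductive Reaches (A : OneTA Q α) : Q → ℝ≥0 → TimedWord α → Q → ℝ≥0 → Prop
  | nil (q : Q) (ν : ℝ≥0) : Reaches A q ν [] q ν
  | cons (θ : Transition Q α) (ν t : ℝ≥0) (w : TimedWord α) (q' : Q) (ν' : ℝ≥0)
      (mem : θ ∈ A.trans) (sat : ν + t ∈ θ.guard.sat)
      (rest : Reaches A θ.tgt (if θ.reset = true then 0 else ν + t) w q' ν') :
      Reaches A θ.src ν ((t, θ.letter) :: w) q' ν'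

/-- The language of a configuration. -/
def langFrom (A : OneTA Q α) (q : Q) (ν : ℝ≥0) : TimedLanguage α :=
  {w | ∃ q' ∈ A.final, ∃ ν' : ℝ≥0, A.Reaches q ν w q' ν'}

/-- The language of an automaton, which is that of its initial configuration. -/
def lang (A : OneTA Q α) : TimedLanguage α :=
  A.langFrom A.init 0

end OneTA

/-- A timed language is 1-DTA recognizable if it is the language of a deterministic one-clock timed
automaton with finitely many states. -/
def IsOneDTARecognizable {α : Type*} (L : TimedLanguage α) : Prop :=
  ∃ (Q : Type) (_ : Finite Q) (A : OneTA Q α), A.IsDeterministic ∧ L = A.lang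

open Classical in
/-- The syntactic reset function of `L`, by recursion on prefixes; the two lemmas below are its
defining equations. -/
noncomputable def syntacticReset {α : Type*} (L : TimedLanguage α) (u : TimedWord α) : ℝ≥0 :=
  List.reverseRecOn (motive := fun _ => ℝ≥0) u 0
    (fun v p r => if IsOneDTARecognizable (residual L (v ++ [p])) then 0 else r + p.1)

theorem syntacticReset_nil {α : Type*} (L : TimedLanguage α) : syntacticReset L [] = 0 := by
  simp [syntacticReset]

open Classical in
theorem syntacticReset_append {α : Type*} (L : TimedLanguage α) (u : TimedWord α) (t : ℝ≥0)
    (a : α) :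
    syntacticReset L (u ++ [(t, a)]) =
      if IsOneDTARecognizable (residual L (u ++ [(t, a)])) then 0 else syntacticReset L u + t := by
  simp [syntacticReset]

/-- A timed word is half-integral if each of its delays is `m / 2` for some natural number `m`. -/
def IsHalfIntegral {α : Type*} (w : TimedWord α) : Prop :=
  ∀ p ∈ w, ∃ m : ℕ, p.1 = (m : ℝ≥0) / 2

/-- The set of half-integral words of a language. -/
def halfIntegralWords {α : Type*} (L : TimedLanguage α) : Set (TimedWord α) :=
  {w | w ∈ L ∧ IsHalfIntegral w}

end OneClock

/-! Every word u has a half-integral companion v such that u and v lead to one state of a common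
machine, with clock values given by `syntacticReset` and lying in one region; hence u and v are both
in the language or both outside it. When the reset functions agree, the same v serves both
languages, and agreement on half-integral words decides u.

The companion is built letter by letter (`HaveCommonState.append`), although a machine need not
reset when the syntactic clock does. The crux is `mem_lang_congr`: a language realised at two
incongruent clock values is insensitive to the position of the clock within its region, because the
two clocks never meet integers simultaneously. Compared with clock value 0, this shows that if one
of the two residuals is recognizable, both are equal, so both words can restart at 0 in a fresh
machine. -/

namespace OneClock

open Topology Filter

/-! ### Regions and incongruent clock values -/

/-- Two clock values are in the same region if they compare in the same way to all natural
numbers. -/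
def SameRegion (x y : ℝ≥0) : Prop :=
  ∀ n : ℕ, (x < n ↔ y < n) ∧ ((n : ℝ≥0) < x ↔ (n : ℝ≥0) < y)

/-- Two clock values are incongruent if their difference is not an integer. -/
def Incongruent (x y : ℝ≥0) : Prop :=
  ∀ m n : ℕ, x + m ≠ y + n

namespace SameRegion

variable {x y z : ℝ≥0}

theorem refl (x : ℝ≥0) : SameRegion x x := fun _ => ⟨Iff.rfl, Iff.rfl⟩

theorem symm (h : SameRegion x y) : SameRegion y x := fun n => ⟨(h n).1.symm, (h n).2.symm⟩

theorem eq_of_eq_natCast (h : SameRegion x y) {n : ℕ} (hx : x = n) : y = n := by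
  have := h n
  simp only [hx, lt_irrefl, false_iff, not_lt] at this
  exact le_antisymm this.2 this.1

theorem of_between (h : SameRegion x z) (hxy : x ≤ y) (hyz : y ≤ z) : SameRegion z y := fun n =>
  ⟨⟨fun hn => hyz.trans_lt hn, fun hn => (h n).1.1 (hxy.trans_lt hn)⟩,
    ⟨fun hn => ((h n).2.2 hn).trans_le hxy, fun hn => hn.trans_le hyz⟩⟩

theorem of_mem_Ioo {n : ℕ} (hx : x ∈ Set.Ioo (n : ℝ≥0) (n + 1))
    (hy : y ∈ Set.Ioo (n : ℝ≥0) (n + 1)) : SameRegion x y := by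
  have key : ∀ z ∈ Set.Ioo (n : ℝ≥0) (n + 1), ∀ m : ℕ,
      (z < m ↔ n + 1 ≤ m) ∧ ((m : ℝ≥0) < z ↔ m ≤ n) := by
    intro z hz m
    refine ⟨⟨fun h => ?_, fun h => ?_⟩, ⟨fun h => ?_, fun h => ?_⟩⟩
    · exact Nat.succ_le_of_lt (by exact_mod_cast hz.1.trans h)
    · exact hz.2.trans_le (by exact_mod_cast h)
    · exact Nat.lt_succ_iff.1 (by exact_mod_cast h.trans hz.2)
    · exact lt_of_le_of_lt (by exact_mod_cast h) hz.1
  exact fun m => ⟨(key x hx m).1.trans (key y hy m).1.symm,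
    (key x hx m).2.trans (key y hy m).2.symm⟩

end SameRegion

theorem mem_Ioo_floor {x : ℝ≥0} (hx : ∀ n : ℕ, x ≠ n) :
    x ∈ Set.Ioo (⌊x⌋₊ : ℝ≥0) (⌊x⌋₊ + 1) :=
  ⟨lt_of_le_of_ne (Nat.floor_le x.2) (hx _).symm, Nat.lt_floor_add_one x⟩

theorem eventually_sameRegion {x : ℝ≥0} (hx : ∀ n : ℕ, x ≠ n) : ∀ᶠ y in 𝓝 x, SameRegion x y :=
  Filter.mem_of_superset (isOpen_Ioo.mem_nhds (mem_Ioo_floor hx))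
    fun _ hy => SameRegion.of_mem_Ioo (mem_Ioo_floor hx) hy

namespace Incongruent

variable {x y : ℝ≥0}

theorem symm (h : Incongruent x y) : Incongruent y x := fun m n e => h n m e.symm

theorem add_right (h : Incongruent x y) (t : ℝ≥0) : Incongruent (x + t) (y + t) := fun m n e =>
  h m n (add_right_cancel (b := t) (by rw [add_right_comm, e, add_right_comm]))

theorem of_forall_ne (h : ∀ n : ℕ, x ≠ n) : Incongruent x 0 := by
  intro m n e
  rw [zero_add] at e
  have hmn : m ≤ n := by
    have : (m : ℝ≥0) ≤ n := e ▸ le_add_self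
    exact_mod_cast this
  obtain ⟨k, rfl⟩ := Nat.exists_eq_add_of_le' hmn
  push_cast at e
  exact h k (add_right_cancel e)

theorem forall_ne_or (h : Incongruent x y) : (∀ n : ℕ, x ≠ n) ∨ ∀ n : ℕ, y ≠ n := by
  by_contra! hc
  obtain ⟨⟨m, hm⟩, n, hn⟩ := hc
  exact h n m (by rw [hm, hn, add_comm])

end Incongruent

theorem ClockConstraint.sat_congr {x y : ℝ≥0} (h : SameRegion x y) (φ : ClockConstraint) :
    x ∈ φ.sat ↔ y ∈ φ.sat := by
  induction φ with
  | gt c => exact (h c).2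
  | eq c => exact ⟨h.eq_of_eq_natCast, h.symm.eq_of_eq_natCast⟩
  | lt c => exact (h c).1
  | and φ ψ hφ hψ => exact and_congr hφ hψ

/-! ### Region machines and insensitivity to the clock -/

/-- A deterministic and total machine with one clock whose steps depend only on the region of the
clock value. A step yields the next state and the information whether the clock is reset. -/
structure RegionMachine (S α : Type*) where
  step : S → ℝ≥0 → α → S × Bool
  accept : Set S
  step_congr : ∀ s x y a, SameRegion x y → step s x a = step s y a

namespace RegionMachine

variable {S α : Type*} (M : RegionMachine S α)

/-- The clock value after reading a letter at clock value `x`. -/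
def clock (s : S) (x : ℝ≥0) (a : α) : ℝ≥0 := if (M.step s x a).2 = true then 0 else x

/-- Acceptance of a timed word from a given state and clock value. -/
def Accepts : TimedWord α → S → ℝ≥0 → Prop
  | [], s, _ => s ∈ M.accept
  | (t, a) :: w, s, x => Accepts w (M.step s (x + t) a).1 (M.clock s (x + t) a)

/-- The language of a state and a clock value. -/
def lang (s : S) (x : ℝ≥0) : TimedLanguage α := {w | M.Accepts w s x}

theorem cons_mem_lang {t : ℝ≥0} {a : α} {w : TimedWord α} {s : S} {x : ℝ≥0} :
    (t, a) :: w ∈ M.lang s x ↔ w ∈ M.lang (M.step s (x + t) a).1 (M.clock s (x + t) a) :=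
  Iff.rfl

theorem residual_lang (t : ℝ≥0) (a : α) (s : S) (x : ℝ≥0) :
    residual (M.lang s x) [(t, a)] = M.lang (M.step s (x + t) a).1 (M.clock s (x + t) a) :=
  rfl

theorem clock_eq_or (s : S) (x : ℝ≥0) (a : α) : M.clock s x a = 0 ∨ M.clock s x a = x := by
  unfold clock
  split_ifs <;> simp

/-- If a configuration has the same language as a configuration with an incongruent clock value,
then its language depends only on the region of the clock value. -/
theorem mem_lang_congr {α : Type*} (w : TimedWord α) : ∀ {S T : Type} (A : RegionMachine S α)
    (B : RegionMachine T α) (s : S) (r : T) (x y : ℝ≥0), A.lang s x = B.lang r y →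
    Incongruent x y → ∀ z, SameRegion x z → (w ∈ A.lang s x ↔ w ∈ A.lang s z) := by
  induction w with
  | nil => exact fun _ _ _ _ _ _ _ _ _ _ => Iff.rfl
  | cons p w ih =>
    obtain ⟨t, a⟩ := p
    -- An integer region is a single point, and a reset forgets the clock. Otherwise the induction
    -- hypothesis applies to the successors, whose clocks remain incongruent.
    have succ_congr : ∀ {S T : Type} (A : RegionMachine S α) (B : RegionMachine T α) (s : S)
        (r : T) (x y : ℝ≥0), A.lang s x = B.lang r y → Incongruent x y → ∀ t z,
        SameRegion (x + t) z →
        (w ∈ A.lang (A.step s (x + t) a).1 (A.clock s (x + t) a) ↔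
          w ∈ A.lang (A.step s z a).1 (A.clock s z a)) := by
      intro S T A B s r x y hL hxy t z hz
      have hstep := A.step_congr s _ _ a hz
      by_cases hint : ∃ n : ℕ, x + t = n
      · obtain ⟨n, hn⟩ := hint
        rw [hz.eq_of_eq_natCast hn, hn]
      push Not at hint
      have hres := congrArg (residual · [(t, a)]) hL
      simp only [residual_lang] at hres
      cases hreset : (A.step s (x + t) a).2 with
      | true => simp only [clock, ← hstep, hreset, if_true]
      | false =>
        simp only [clock, ← hstep, hreset, Bool.false_eq_true, if_false] at hres ⊢
        refine ih A B _ _ _ _ hres ?_ z hz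
        -- If B resets, its clock 0 is incongruent to the non-integer `x + t`; if not, both clocks
        -- have grown by `t`.
        rcases B.clock_eq_or r (y + t) a with h | h
        · rw [clock] at h
          rw [h]
          exact .of_forall_ne hint
        · rw [clock] at h
          rw [h]
          exact hxy.add_right t
    intro S T A B s r x y hL hxy z hz
    have hmem : ∀ t, (w ∈ A.lang (A.step s (x + t) a).1 (A.clock s (x + t) a) ↔
        w ∈ B.lang (B.step r (y + t) a).1 (B.clock r (y + t) a)) := fun t => by
      rw [← cons_mem_lang, ← cons_mem_lang, hL]
    -- Near any delay, at least one of the two clocks stays in its open region, and membership can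
    -- be read off on that side. Connectedness of `ℝ≥0` then makes it independent of the delay.
    have hconst : IsLocallyConstant fun t : ℝ≥0 =>
        w ∈ A.lang (A.step s (x + t) a).1 (A.clock s (x + t) a) := by
      rw [IsLocallyConstant.iff_eventually_eq]
      intro t
      rcases (hxy.add_right t).forall_ne_or with h | h
      · have hc : Tendsto (fun t' => x + t') (𝓝 t) (𝓝 (x + t)) :=
          (continuous_const_add x).tendsto t
        filter_upwards [hc.eventually (eventually_sameRegion h)] with t' ht'
        exact propext (succ_congr A B s r x y hL hxy t _ ht').symm
      · have hc : Tendsto (fun t' => y + t') (𝓝 t) (𝓝 (y + t)) :=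
          (continuous_const_add y).tendsto t
        filter_upwards [hc.eventually (eventually_sameRegion h)] with t' ht'
        rw [hmem, hmem]
        exact propext (succ_congr B A r s y x hL.symm hxy.symm t _ ht').symm
    rw [cons_mem_lang, cons_mem_lang]
    -- Either `z + t` is reached from `x` by a delay, or it lies between `z` and `x`, hence in the
    -- region of `x`, and delay 0 serves for comparison.
    rcases le_total x (z + t) with h | h
    · obtain ⟨t', ht'⟩ := exists_add_of_le h
      rw [ht']
      exact iff_of_eq (hconst.apply_eq_of_preconnectedSpace t t')
    · have h₀ := succ_congr A B s r x y hL hxy 0 (z + t)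
        (by simpa using hz.symm.of_between le_self_add h)
      exact (iff_of_eq (hconst.apply_eq_of_preconnectedSpace t 0)).trans h₀

theorem lang_congr {α : Type*} {S T : Type} {A : RegionMachine S α} {B : RegionMachine T α}
    {s : S} {r : T} {x y : ℝ≥0} (hL : A.lang s x = B.lang r y) (hxy : Incongruent x y) {z : ℝ≥0}
    (hz : SameRegion x z) : A.lang s x = A.lang s z :=
  Set.ext fun w => mem_lang_congr w A B s r x y hL hxy z hz

end RegionMachine

/-! ### From deterministic automata to region machines -/

namespace OneTA

variable {Q α : Type*} (A : OneTA Q α)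

/-- A transition is enabled if it has the given source and letter and its guard holds. -/
def Enabled (q : Q) (x : ℝ≥0) (a : α) (θ : Transition Q α) : Prop :=
  θ ∈ A.trans ∧ θ.src = q ∧ θ.letter = a ∧ x ∈ θ.guard.sat

theorem enabled_congr {x y : ℝ≥0} (h : SameRegion x y) (q : Q) (a : α) :
    A.Enabled q x a = A.Enabled q y a := by
  funext θ
  simp only [Enabled, ClockConstraint.sat_congr h]

variable {A} in
theorem IsDeterministic.enabled_unique (hA : A.IsDeterministic) {q : Q} {x : ℝ≥0} {a : α}
    {θ θ' : Transition Q α} (h : A.Enabled q x a θ) (h' : A.Enabled q x a θ') : θ = θ' := by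
  by_contra hne
  rcases hA θ h.1 θ' h'.1 hne with h₁ | h₁ | h₁
  · exact h₁ (h.2.1.trans h'.2.1.symm)
  · exact h₁ (h.2.2.1.trans h'.2.2.1.symm)
  · exact (Set.eq_empty_iff_forall_notMem.1 h₁ x) ⟨h.2.2.2, h'.2.2.2⟩

open Classical in
/-- The state and reset information of some transition with the given property, or else those of
the sink `none`. -/
noncomputable def ofEnabled (P : Transition Q α → Prop) : Option Q × Bool :=
  if h : ∃ θ, P θ then (some h.choose.tgt, h.choose.reset) else (none, true)

/-- The state and reset information after a step, with `none` as a rejecting sink. -/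
noncomputable def totalStep : Option Q → ℝ≥0 → α → Option Q × Bool
  | none, _, _ => (none, true)
  | some q, x, a => ofEnabled (A.Enabled q x a)

/-- The machine obtained from an automaton by adding a rejecting sink. -/
noncomputable def toRegionMachine : RegionMachine (Option Q) α where
  step := A.totalStep
  accept := some '' A.final
  step_congr := by
    rintro (_ | q) x y a h
    · rfl
    · exact congrArg ofEnabled (A.enabled_congr h q a)

theorem toRegionMachine_lang_none (x : ℝ≥0) : A.toRegionMachine.lang none x = ∅ := by
  refine Set.eq_empty_iff_forall_notMem.2 fun w => ?_
  induction w generalizing x with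
  | nil => rintro ⟨q, -, hq⟩; cases hq
  | cons p w ih => exact ih _

theorem cons_mem_langFrom {t : ℝ≥0} {a : α} {w : TimedWord α} {q : Q} {x : ℝ≥0} :
    (t, a) :: w ∈ A.langFrom q x ↔
      ∃ θ, A.Enabled q (x + t) a θ ∧
        w ∈ A.langFrom θ.tgt (if θ.reset = true then 0 else x + t) := by
  constructor
  · rintro ⟨q', hq', x', h⟩
    cases h with
    | cons θ _ _ _ _ _ mem sat rest => exact ⟨θ, ⟨mem, rfl, rfl, sat⟩, q', hq', x', rest⟩
  · rintro ⟨θ, ⟨mem, rfl, rfl, sat⟩, q', hq', x', rest⟩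
    exact ⟨q', hq', x', .cons θ _ _ _ _ _ mem sat rest⟩

variable {A} in
theorem IsDeterministic.toRegionMachine_lang_some (hA : A.IsDeterministic) (q : Q) (x : ℝ≥0) :
    A.toRegionMachine.lang (some q) x = A.langFrom q x := by
  ext w
  induction w generalizing q x with
  | nil =>
    constructor
    · rintro ⟨q', hq', h⟩
      cases h
      exact ⟨q, hq', x, .nil q x⟩
    · rintro ⟨q', hq', x', h⟩
      cases h
      exact ⟨q, hq', rfl⟩
  | cons p w ih =>
    obtain ⟨t, a⟩ := p
    rw [RegionMachine.cons_mem_lang, cons_mem_langFrom]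
    by_cases h : ∃ θ, A.Enabled q (x + t) a θ
    · have hstep : A.toRegionMachine.step (some q) (x + t) a =
          (some h.choose.tgt, h.choose.reset) := dif_pos h
      rw [RegionMachine.clock, hstep, ih]
      refine ⟨fun hw => ⟨_, h.choose_spec, hw⟩, ?_⟩
      rintro ⟨θ, hθ, hw⟩
      rwa [hA.enabled_unique h.choose_spec hθ]
    · have hstep : A.toRegionMachine.step (some q) (x + t) a = (none, true) := dif_neg h
      rw [hstep, toRegionMachine_lang_none]
      exact ⟨False.elim, fun ⟨θ, hθ, _⟩ => h ⟨θ, hθ⟩⟩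

end OneTA

variable {α : Type*}

theorem isOneDTARecognizable_empty : IsOneDTARecognizable (∅ : TimedLanguage α) :=
  ⟨Unit, inferInstance, ⟨(), ∅, Set.finite_empty, ∅⟩, fun _ h => h.elim,
    (Set.eq_empty_iff_forall_notMem.2 (by rintro _ ⟨_, h, _⟩; exact h)).symm⟩

/-- A machine all of whose states have a recognizable language at clock value zero. -/
def RegionMachine.IsRecognizable {S : Type} (M : RegionMachine S α) : Prop :=
  ∀ s, IsOneDTARecognizable (M.lang s 0)

/-- Any state may be made initial. Finiteness of the automaton is needed only here; later arguments
use just this property of the machine. -/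
theorem OneTA.IsDeterministic.toRegionMachine_isRecognizable {Q : Type} [Finite Q] {A : OneTA Q α}
    (hA : A.IsDeterministic) : A.toRegionMachine.IsRecognizable := by
  rintro (_ | q)
  · rw [toRegionMachine_lang_none]
    exact isOneDTARecognizable_empty
  · have hA' : IsDeterministic { A with init := q } := hA
    exact ⟨Q, inferInstance, { A with init := q }, hA', hA'.toRegionMachine_lang_some q 0⟩

theorem IsOneDTARecognizable.exists_regionMachine {L : TimedLanguage α}
    (h : IsOneDTARecognizable L) :
    ∃ (S : Type) (M : RegionMachine S α) (s : S), M.IsRecognizable ∧ L = M.lang s 0 := by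
  obtain ⟨Q, _, A, hA, rfl⟩ := h
  exact ⟨_, A.toRegionMachine, some A.init, hA.toRegionMachine_isRecognizable,
    (hA.toRegionMachine_lang_some _ _).symm⟩

/-! ### The invariant relating a word to its companion -/

theorem residual_append (L : TimedLanguage α) (u v : TimedWord α) :
    residual L (u ++ v) = residual (residual L u) v := by
  ext w
  simp [residual]

theorem mem_iff_nil_mem_residual {L : TimedLanguage α} {u : TimedWord α} :
    u ∈ L ↔ [] ∈ residual L u := by
  simp [residual]

/-- The residuals by `u` and `v` are the languages of one state of a machine, at the clock values
given by the syntactic reset function. -/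
def HaveCommonState (L : TimedLanguage α) (u v : TimedWord α) : Prop :=
  ∃ (S : Type) (M : RegionMachine S α) (s : S), M.IsRecognizable ∧
    residual L u = M.lang s (syntacticReset L u) ∧ residual L v = M.lang s (syntacticReset L v)

namespace HaveCommonState

variable {L : TimedLanguage α} {u v : TimedWord α}

theorem mem_iff (h : HaveCommonState L u v) : u ∈ L ↔ v ∈ L := by
  obtain ⟨S, M, s, -, hu, hv⟩ := h
  rw [mem_iff_nil_mem_residual (u := u), mem_iff_nil_mem_residual (u := v), hu, hv]
  exact Iff.rfl

theorem of_residual_eq {p q : ℝ≥0 × α} (h : residual L (u ++ [p]) = residual L (v ++ [q]))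
    (hrec : IsOneDTARecognizable (residual L (u ++ [p]))) :
    syntacticReset L (u ++ [p]) = 0 ∧ syntacticReset L (v ++ [q]) = 0 ∧
      HaveCommonState L (u ++ [p]) (v ++ [q]) := by
  have hu : syntacticReset L (u ++ [p]) = 0 := by
    rw [syntacticReset_append L u p.1 p.2, if_pos hrec]
  have hv : syntacticReset L (v ++ [q]) = 0 := by
    rw [syntacticReset_append L v q.1 q.2, if_pos (h ▸ hrec)]
  obtain ⟨S, M, s, hM, hs⟩ := hrec.exists_regionMachine
  exact ⟨hu, hv, S, M, s, hM, by rw [hu, hs], by rw [hv, ← h, hs]⟩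

/-- Either both syntactic clocks reset, and a new machine is chosen for the common residual, or
neither does, and the old machine does not reset either. -/
theorem append (h : HaveCommonState L u v) {t t' : ℝ≥0} (a : α)
    (hreg : SameRegion (syntacticReset L u + t) (syntacticReset L v + t')) :
    HaveCommonState L (u ++ [(t, a)]) (v ++ [(t', a)]) ∧
      SameRegion (syntacticReset L (u ++ [(t, a)])) (syntacticReset L (v ++ [(t', a)])) := by
  by_cases heq : residual L (u ++ [(t, a)]) = residual L (v ++ [(t', a)]) ∧
      IsOneDTARecognizable (residual L (u ++ [(t, a)]))
  · obtain ⟨hu, hv, hc⟩ := of_residual_eq heq.1 heq.2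
    exact ⟨hc, by rw [hu, hv]; exact .refl 0⟩
  obtain ⟨S, M, s, hM, hu, hv⟩ := h
  have hstep := M.step_congr s _ _ a hreg
  have hu' : residual L (u ++ [(t, a)]) = M.lang (M.step s (syntacticReset L u + t) a).1
      (M.clock s (syntacticReset L u + t) a) := by
    rw [residual_append, hu, M.residual_lang]
  have hv' : residual L (v ++ [(t', a)]) = M.lang (M.step s (syntacticReset L u + t) a).1
      (M.clock s (syntacticReset L v + t') a) := by
    rw [residual_append, hv, M.residual_lang, hstep]
  cases hreset : (M.step s (syntacticReset L u + t) a).2 with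
  | true =>
    simp only [RegionMachine.clock, ← hstep, hreset, if_true] at hu' hv'
    exact (heq ⟨hu'.trans hv'.symm, hu' ▸ hM _⟩).elim
  | false =>
    simp only [RegionMachine.clock, ← hstep, hreset, Bool.false_eq_true, if_false] at hu' hv'
    generalize (M.step s (syntacticReset L u + t) a).1 = s' at hu' hv'
    -- A recognizable language is also realised at clock value 0, which is incongruent to every
    -- non-integer `x`.
    have hne : ∀ x y : ℝ≥0, SameRegion x y → IsOneDTARecognizable (M.lang s' x) →
        M.lang s' x = M.lang s' y := by
      intro x y hxy hrec
      by_cases hint : ∃ n : ℕ, x = n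
      · obtain ⟨n, hn⟩ := hint
        rw [hxy.eq_of_eq_natCast hn, hn]
      push Not at hint
      obtain ⟨T, B, r, -, hr⟩ := hrec.exists_regionMachine
      exact RegionMachine.lang_congr hr (.of_forall_ne hint) hxy
    have hnu : ¬ IsOneDTARecognizable (residual L (u ++ [(t, a)])) := fun hrec =>
      heq ⟨by rw [hu', hv']; exact hne _ _ hreg (hu' ▸ hrec), hrec⟩
    have hnv : ¬ IsOneDTARecognizable (residual L (v ++ [(t', a)])) := fun hrec =>
      hnu (by rw [hu', ← hne _ _ hreg.symm (hv' ▸ hrec), ← hv']; exact hrec)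
    have hRu := syntacticReset_append L u t a
    have hRv := syntacticReset_append L v t' a
    rw [if_neg hnu] at hRu
    rw [if_neg hnv] at hRv
    exact ⟨⟨S, M, s', hM, by rw [hu', hRu], by rw [hv', hRv]⟩, by rwa [hRu, hRv]⟩

end HaveCommonState

/-! ### Half-integral companions -/

/-- A delay can be matched, up to regions, by a half-integral one from a half-integral clock
value. -/
theorem exists_half_delay {x y : ℝ≥0} (hxy : SameRegion x y) {k : ℕ} (hy : y = (k : ℝ≥0) / 2)
    (t : ℝ≥0) : ∃ m : ℕ, SameRegion (x + t) (y + (m : ℝ≥0) / 2) := by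
  by_cases hint : ∃ n : ℕ, x + t = n
  · obtain ⟨n, hn⟩ := hint
    have hyn : y ≤ n := not_lt.1 fun h => (((hxy n).2.2 h).trans_le le_self_add).ne hn.symm
    have hk : k ≤ 2 * n := by
      rw [hy, div_le_iff₀ two_pos] at hyn
      have : k ≤ n * 2 := by exact_mod_cast hyn
      omega
    -- This `m` brings the clock exactly to `n`.
    obtain ⟨m, hm⟩ := Nat.exists_eq_add_of_le hk
    refine ⟨m, ?_⟩
    have : y + (m : ℝ≥0) / 2 = n := by
      rw [hy, ← add_div, ← Nat.cast_add, ← hm]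
      simp
    rw [hn, this]
    exact .refl _
  push Not at hint
  have hmem := mem_Ioo_floor hint
  generalize ⌊x + t⌋₊ = n at hmem
  have hyn : y < (n + 1 : ℕ) :=
    (hxy (n + 1)).1.1 (le_self_add.trans_lt (by exact_mod_cast hmem.2))
  have hk : k ≤ 2 * n + 1 := by
    rw [hy, div_lt_iff₀ two_pos] at hyn
    have : k < (n + 1) * 2 := by exact_mod_cast hyn
    omega
  -- Here the target is the midpoint `n + 1/2` of the open region.
  obtain ⟨m, hm⟩ := Nat.exists_eq_add_of_le hk
  refine ⟨m, .of_mem_Ioo hmem ?_⟩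
  have : y + (m : ℝ≥0) / 2 = n + 1 / 2 := by
    rw [hy, ← add_div, ← Nat.cast_add, ← hm]
    push_cast
    rw [add_div, mul_div_cancel_left₀ _ two_ne_zero]
  rw [this]
  exact ⟨lt_add_of_pos_right _ (by positivity), by gcongr; exact NNReal.half_lt_self one_ne_zero⟩

theorem exists_half_syntacticReset (L : TimedLanguage α) {v : TimedWord α}
    (hv : IsHalfIntegral v) : ∃ k : ℕ, syntacticReset L v = (k : ℝ≥0) / 2 := by
  induction v using List.reverseRecOn with
  | nil => exact ⟨0, by simp [syntacticReset_nil]⟩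
  | append_singleton v p ih =>
    obtain ⟨t, a⟩ := p
    obtain ⟨k, hk⟩ := ih fun p hp => hv p (List.mem_append_left _ hp)
    obtain ⟨m, hm⟩ := hv (t, a) (by simp)
    rw [syntacticReset_append]
    split_ifs
    · exact ⟨0, by simp⟩
    · exact ⟨k + m, by rw [hk, show t = (m : ℝ≥0) / 2 from hm]; push_cast; rw [add_div]⟩

/-- Every word has a half-integral companion that two languages with the same syntactic reset
function do not distinguish from it. -/
theorem exists_halfIntegral_companion {L₁ L₂ : TimedLanguage α} (h₁ : IsOneDTARecognizable L₁)
    (h₂ : IsOneDTARecognizable L₂) (hR : syntacticReset L₁ = syntacticReset L₂)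
    (u : TimedWord α) :
    ∃ v, IsHalfIntegral v ∧ SameRegion (syntacticReset L₁ u) (syntacticReset L₁ v) ∧
      HaveCommonState L₁ u v ∧ HaveCommonState L₂ u v := by
  induction u using List.reverseRecOn with
  | nil =>
    have base : ∀ {L : TimedLanguage α}, IsOneDTARecognizable L → HaveCommonState L [] [] := by
      intro L h
      obtain ⟨S, M, s, hM, rfl⟩ := h.exists_regionMachine
      exact ⟨S, M, s, hM, by rw [syntacticReset_nil]; rfl, by rw [syntacticReset_nil]; rfl⟩
    exact ⟨[], by simp [IsHalfIntegral], .refl _, base h₁, base h₂⟩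
  | append_singleton u p ih =>
    obtain ⟨t, a⟩ := p
    obtain ⟨v, hv, hreg, hc₁, hc₂⟩ := ih
    obtain ⟨k, hk⟩ := exists_half_syntacticReset L₁ hv
    obtain ⟨m, hm⟩ := exists_half_delay hreg hk t
    have hc₁' := hc₁.append a hm
    refine ⟨v ++ [((m : ℝ≥0) / 2, a)], ?_, hc₁'.2, hc₁'.1, (hc₂.append a (hR ▸ hm)).1⟩
    intro p hp
    rcases List.mem_append.1 hp with hp | hp
    · exact hv p hp
    · rw [List.mem_singleton.1 hp]
      exact ⟨m, rfl⟩

end OneClock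

theorem theorem2 {α : Type*} [Finite α] (L₁ L₂ : OneClock.TimedLanguage α)
    (h₁ : OneClock.IsOneDTARecognizable L₁) (h₂ : OneClock.IsOneDTARecognizable L₂) :
    L₁ = L₂ ↔
      OneClock.halfIntegralWords L₁ = OneClock.halfIntegralWords L₂ ∧
        OneClock.syntacticReset L₁ = OneClock.syntacticReset L₂ := by
  refine ⟨fun h => h ▸ ⟨rfl, rfl⟩, fun ⟨hHI, hR⟩ => Set.ext fun u => ?_⟩
  obtain ⟨v, hv, -, hc₁, hc₂⟩ := OneClock.exists_halfIntegral_companion h₁ h₂ hR u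
  have hmem : v ∈ L₁ ↔ v ∈ L₂ := by
    have := Set.ext_iff.1 hHI v
    simpa [OneClock.halfIntegralWords, hv] using this
  rw [hc₁.mem_iff, hmem, hc₂.mem_iff]
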